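/- Let $d \ge 0$ be an integer. A bounded, measurable set $\Omega \subset \mathbb{R}^d$ of positive Lebesgue measure is called spectral if there exists a countable set $\Lambda \subset \mathbb{R}^d$ such that the system of exponential functions $e_\lambda(x) = e^{2\pi i \langle \lambda, x\rangle}$, $\lambda \in \Lambda$, is orthogonal and complete in $L^2(\Omega)$. Let $\Omega$ be a bounded, open set in $\mathbb{R}^d$. If $\Omega$ is spectral, then its boundary $\partial\Omega$ is a set of Lebesgue measure zero. -/

import Mathlib

open MeasureTheory

/-- The exponential function `e_l(x) = exp (2 π i ⟨l, x⟩)` on `ℝ^d`. -/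
noncomputable def expFun {d : ℕ} (l x : EuclideanSpace ℝ (Fin d)) : ℂ :=
  Complex.exp (2 * (Real.pi : ℂ) * Complex.I * ((inner ℝ l x : ℝ) : ℂ))

theorem continuous_expFun {d : ℕ} (l : EuclideanSpace ℝ (Fin d)) : Continuous (expFun l) := by
  unfold expFun
  fun_prop

theorem norm_expFun {d : ℕ} (l x : EuclideanSpace ℝ (Fin d)) : ‖expFun l x‖ = 1 := by
  have h : 2 * (Real.pi : ℂ) * Complex.I * ((inner ℝ l x : ℝ) : ℂ)
      = ((2 * Real.pi * inner ℝ l x : ℝ) : ℂ) * Complex.I := by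
    push_cast
    ring
  rw [expFun, h, Complex.norm_exp_ofReal_mul_I]

theorem memLp_expFun {d : ℕ} {Ω : Set (EuclideanSpace ℝ (Fin d))}
    (hΩ : Bornology.IsBounded Ω) (l : EuclideanSpace ℝ (Fin d)) :
    MemLp (expFun l) 2 (volume.restrict Ω) := by
  have : IsFiniteMeasure (volume.restrict Ω) := isFiniteMeasure_restrict.2 hΩ.measure_lt_top.ne
  exact MemLp.of_bound (continuous_expFun l).aestronglyMeasurable 1
    (Filter.Eventually.of_forall fun x => (norm_expFun l x).le)

/-- The exponential function `e_l`, as an element of the complex Hilbert space `L²(Ω)`,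
for a bounded set `Ω`. -/
noncomputable def expL2 {d : ℕ} {Ω : Set (EuclideanSpace ℝ (Fin d))}
    (hΩ : Bornology.IsBounded Ω) (l : EuclideanSpace ℝ (Fin d)) :
    Lp ℂ 2 (volume.restrict Ω) :=
  (memLp_expFun hΩ l).toLp (expFun l)

/-- `Λ` is a spectrum for the bounded set `Ω`: it is countable, and the system of exponentials
`{e_l}`, `l ∈ Λ`, is orthogonal and complete in `L²(Ω)`. -/
structure IsSpectrum {d : ℕ} {Ω : Set (EuclideanSpace ℝ (Fin d))}
    (hΩ : Bornology.IsBounded Ω) (Λ : Set (EuclideanSpace ℝ (Fin d))) : Prop where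
  countable : Λ.Countable
  orthogonal : Λ.Pairwise fun l l' => inner ℂ (expL2 hΩ l) (expL2 hΩ l') = 0
  complete : (Submodule.span ℂ (expL2 hΩ '' Λ)).topologicalClosure = ⊤

/-- A set `Ω ⊆ ℝ^d` is spectral if it is bounded, measurable, of positive Lebesgue measure,
and admits a spectrum. -/
def IsSpectral {d : ℕ} (Ω : Set (EuclideanSpace ℝ (Fin d))) : Prop :=
  MeasurableSet Ω ∧ 0 < volume Ω ∧
    ∃ (hΩ : Bornology.IsBounded Ω) (Λ : Set (EuclideanSpace ℝ (Fin d))), IsSpectrum hΩ Λ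

open Metric Topology Filter
open scoped ENNReal Pointwise

/-! Let `T` be a trigonometric polynomial with frequencies in `Λ`. By orthogonality `|T|²` has the
same integral over every translate of `Ω`; by completeness `T` can be taken close in `L²(Ω)` to the
indicator of a small ball about a point `p ∈ Ω`. Recentring `|T|²` at `p` and normalising gives `ν`
with `ν (Ω - x) = 1` for all `x` and nearly all the mass of `Ω - p` near the origin
(`IsSpectrum.exists_measure`).

Put `F u = |∂Ω ∩ (Ω - u)|`. By Tonelli `∫ F dν = |∂Ω|`. But `F 0 = 0`, `F` is upper semicontinuous
with bounded support, and `ν` has little mass on `{F ≥ η}`, so the integral is arbitrarily small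
(`volume_frontier_eq_zero_of_forall_exists_measure`). -/

/-! ### Concentrating measures force a null boundary. -/

/-- Upper semicontinuity: for compact `K`, the part of `v + K` outside `u + K` has small volume when
`v` is near `u`. -/
theorem isClosed_setOf_le_measure_add_mem {d : ℕ} {K U : Set (EuclideanSpace ℝ (Fin d))}
    (hK : IsCompact K) (η : ℝ≥0∞) :
    IsClosed {u | η ≤ volume {q | q ∈ K ∧ u + q ∈ U}} := by
  rw [← isOpen_compl_iff, isOpen_iff_mem_nhds]
  intro u hu
  simp only [Set.mem_compl_iff, Set.mem_ofPred_eq, not_le] at hu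
  have htrans : ∀ v : EuclideanSpace ℝ (Fin d),
      volume {q | q ∈ K ∧ v + q ∈ U} = volume ((v +ᵥ K) ∩ U) := by
    intro v
    have : {q | q ∈ K ∧ v + q ∈ U} = (fun q => v + q) ⁻¹' ((v +ᵥ K) ∩ U) := by
      ext q
      simp [Set.mem_vadd_set]
    rw [this, measure_preimage_add]
  rw [htrans] at hu
  have hev := eventually_nhds_zero_measure_vadd_sdiff_lt (μ := volume) (hK.vadd u)
    (hK.vadd u).isClosed (ε := η - volume ((u +ᵥ K) ∩ U)) (tsub_pos_of_lt hu).ne'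
  have hcont : Tendsto (fun v => v - u) (𝓝 u) (𝓝 0) := by
    simpa using (continuous_id.sub continuous_const).tendsto (f := fun v => v - u) u
  filter_upwards [hcont.eventually hev] with v hv
  simp only [Set.mem_compl_iff, Set.mem_ofPred_eq, not_le]
  rw [vadd_vadd, sub_add_cancel] at hv
  rw [htrans]
  calc volume ((v +ᵥ K) ∩ U)
      ≤ volume ((u +ᵥ K) ∩ U ∪ (v +ᵥ K) \ (u +ᵥ K)) := by
        apply measure_mono
        intro z hz
        by_cases h : z ∈ u +ᵥ K
        · exact Or.inl ⟨h, hz.2⟩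
        · exact Or.inr ⟨hz.1, h⟩
    _ ≤ volume ((u +ᵥ K) ∩ U) + volume ((v +ᵥ K) \ (u +ᵥ K)) := measure_union_le _ _
    _ < η := by
        rw [add_comm]
        exact lt_tsub_iff_right.1 hv

/-- A Tonelli identity: averaging `ν {u | u + q ∈ U}` over `q ∈ K`. -/
theorem lintegral_measure_add_mem {d : ℕ} {K U : Set (EuclideanSpace ℝ (Fin d))}
    (hK : MeasurableSet K) (hU : MeasurableSet U)
    (ν : Measure (EuclideanSpace ℝ (Fin d))) [SFinite ν] :
    ∫⁻ u, volume {q | q ∈ K ∧ u + q ∈ U} ∂ν = ∫⁻ q in K, ν {u | u + q ∈ U} := by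
  have hmeas : MeasurableSet {z : EuclideanSpace ℝ (Fin d) × EuclideanSpace ℝ (Fin d) |
      z.1 + z.2 ∈ U} := measurable_add hU
  have h1 := Measure.prod_apply (μ := ν) (ν := volume.restrict K) hmeas
  rw [Measure.prod_apply_symm hmeas] at h1
  simp only [Set.preimage_ofPred_eq] at h1
  rw [h1]
  refine lintegral_congr fun u => ?_
  rw [Measure.restrict_apply' hK]
  congr 1
  ext q
  simp [and_comm]

theorem exists_finset_subset_biUnion_add_mem {d : ℕ} {U K S : Set (EuclideanSpace ℝ (Fin d))}
    (hU : IsOpen U) (hK : IsCompact K) (h : ∀ u ∈ K, ∃ q ∈ S, u + q ∈ U) :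
    ∃ s : Finset (EuclideanSpace ℝ (Fin d)), (↑s ⊆ S) ∧ K ⊆ ⋃ q ∈ s, {u | u + q ∈ U} := by
  obtain ⟨t, ht, htf, hcov⟩ := hK.elim_finite_subcover_image (b := S)
    (c := fun q => {u | u + q ∈ U}) (fun q _ => hU.preimage (continuous_add_const q))
    (fun u hu => by
      obtain ⟨q, hq, hqu⟩ := h u hu
      exact Set.mem_biUnion hq hqu)
  refine ⟨htf.toFinset, by simpa using ht, by simpa using hcov⟩

/-- If there are measures giving mass one to each reflected translate of a bounded open set and
concentrating near the origin in that all but a small mass of one such translate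
lies in a small ball, then the boundary of the set is null. -/
theorem volume_frontier_eq_zero_of_forall_exists_measure {d : ℕ}
    {Ω : Set (EuclideanSpace ℝ (Fin d))}
    (hbdd : Bornology.IsBounded Ω) (hopen : IsOpen Ω) (hne : Ω.Nonempty)
    (h : ∀ ε > 0, ∀ δ : ℝ≥0∞, δ ≠ 0 → ∃ ν : Measure (EuclideanSpace ℝ (Fin d)), SFinite ν ∧
      (∀ x, ν {u | u + x ∈ Ω} = 1) ∧ 1 ≤ ν (ball 0 ε) + δ) :
    volume (frontier Ω) = 0 := by
  have hcl : IsCompact (closure Ω) := hbdd.isCompact_closure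
  have hfr : IsCompact (frontier Ω) := hcl.of_isClosed_subset isClosed_frontier
    frontier_subset_closure
  have hfin : volume (frontier Ω) ≠ ∞ := hfr.measure_lt_top.ne
  set F : EuclideanSpace ℝ (Fin d) → ℝ≥0∞ :=
    fun u => volume {q | q ∈ frontier Ω ∧ u + q ∈ Ω} with hF
  have hFle : ∀ u, F u ≤ volume (frontier Ω) := fun u => measure_mono fun q hq => hq.1
  have hex : ∀ u, F u ≠ 0 → ∃ q ∈ frontier Ω, u + q ∈ Ω := fun u hu =>
    nonempty_of_measure_ne_zero hu
  -- the support of `F` lies in a compact set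
  set K : Set (EuclideanSpace ℝ (Fin d)) :=
    (fun z : EuclideanSpace ℝ (Fin d) × EuclideanSpace ℝ (Fin d) => z.1 - z.2) ''
      (closure Ω ×ˢ closure Ω) with hKdef
  have hK : IsCompact K := (hcl.prod hcl).image (continuous_fst.sub continuous_snd)
  have hFK : ∀ u, F u ≠ 0 → u ∈ K := by
    intro u hu
    obtain ⟨q, hq, hqu⟩ := hex u hu
    exact ⟨(u + q, q), ⟨subset_closure hqu, frontier_subset_closure hq⟩, by simp⟩
  obtain ⟨p, hp⟩ := hne
  obtain ⟨sK, -, hsK⟩ := exists_finset_subset_biUnion_add_mem (S := Set.univ) hopen hK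
    (fun u _ => ⟨p - u, Set.mem_univ _, by simpa using hp⟩)
  -- it suffices to bound the volume by a multiple of an arbitrary `η`
  suffices hη : ∀ η : ℝ≥0∞, η ≠ 0 → volume (frontier Ω) ≤ η * sK.card by
    have hlim : Tendsto (fun η : ℝ≥0∞ => η * (sK.card : ℝ≥0∞)) (𝓝[≠] 0) (𝓝 (0 * sK.card)) :=
      (ENNReal.Tendsto.mul_const tendsto_id (Or.inr (ENNReal.natCast_ne_top _))).mono_left
        nhdsWithin_le_nhds
    rw [zero_mul] at hlim
    exact le_zero_iff.1 (ge_of_tendsto hlim (eventually_mem_nhdsWithin.mono hη))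
  intro η hη
  set V := {u | η ≤ F u} with hVdef
  have hVclosed : IsClosed V := isClosed_setOf_le_measure_add_mem hfr η
  have hVF : ∀ u ∈ V, F u ≠ 0 := fun u hu h0 => hη (le_zero_iff.1 (h0 ▸ hu))
  have hV : IsCompact V := hK.of_isClosed_subset hVclosed fun u hu => hFK u (hVF u hu)
  -- An open set misses its frontier, so `F 0 = 0`.
  have hV0 : (0 : EuclideanSpace ℝ (Fin d)) ∈ Vᶜ := by
    intro h0
    obtain ⟨q, hq, hq'⟩ := hex 0 (hVF 0 h0)
    rw [zero_add] at hq'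
    rw [hopen.frontier_eq] at hq
    exact hq.2 hq'
  -- Since `Ω` is open, a frontier point `q` with `u + q ∈ Ω` can be moved slightly into `Ω`.
  -- Centres in `Ω` make each covering set a neighbourhood of the origin.
  obtain ⟨sV, hsVΩ, hsV⟩ := exists_finset_subset_biUnion_add_mem (S := Ω) hopen hV (by
    intro u hu
    obtain ⟨q, hq, hqu⟩ := hex u (hVF u hu)
    have hnear : {q' | u + q' ∈ Ω} ∈ 𝓝 q :=
      (hopen.preimage (continuous_const_add u)).mem_nhds hqu
    obtain ⟨q', hq', hq''⟩ := mem_closure_iff_nhds.1 (frontier_subset_closure hq) _ hnear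
    exact ⟨q', hq'', hq'⟩)
  -- a common radius
  have hrad : ∀ᶠ ε in 𝓝[>] (0 : ℝ), ball (0 : EuclideanSpace ℝ (Fin d)) ε ⊆ Vᶜ ∧
      ∀ q ∈ sV, ball q ε ⊆ Ω := by
    refine (eventually_ball_subset (hVclosed.isOpen_compl.mem_nhds hV0)).filter_mono
      nhdsWithin_le_nhds |>.and ?_
    rw [eventually_all_finset]
    intro q hq
    exact (eventually_ball_subset (hopen.mem_nhds (hsVΩ hq))).filter_mono nhdsWithin_le_nhds
  obtain ⟨ε, ⟨hε1, hε2⟩, hε⟩ := (hrad.and eventually_mem_nhdsWithin).exists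
  -- `sK`, `sV` and `ε` do not depend on `δ`, so `δ → 0` is harmless.
  suffices hδ : ∀ δ : ℝ≥0∞, δ ≠ 0 →
      volume (frontier Ω) ≤ η * sK.card + volume (frontier Ω) * (sV.card * δ) by
    have hlim : Tendsto
        (fun δ : ℝ≥0∞ => η * sK.card + volume (frontier Ω) * ((sV.card : ℝ≥0∞) * δ)) (𝓝[≠] 0)
        (𝓝 (η * sK.card + volume (frontier Ω) * (sV.card * 0))) :=
      (tendsto_const_nhds.add (ENNReal.Tendsto.const_mul (ENNReal.Tendsto.const_mul tendsto_id
        (Or.inr (ENNReal.natCast_ne_top _))) (Or.inr hfin))).mono_left nhdsWithin_le_nhds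
    rw [mul_zero, mul_zero, add_zero] at hlim
    exact ge_of_tendsto hlim (eventually_mem_nhdsWithin.mono hδ)
  intro δ hδ
  obtain ⟨ν, hν, hν1, hνε⟩ := h ε hε δ hδ
  -- Each such set has mass one and contains the ball, which already carries mass at least `1 - δ`.
  have hball : ∀ q ∈ sV, ν ({u | u + q ∈ Ω} \ ball 0 ε) ≤ δ := by
    intro q hq
    have hsub : ball 0 ε ⊆ {u | u + q ∈ Ω} := by
      intro u hu
      apply hε2 q hq
      simpa using hu
    have hb : ν (ball 0 ε) ≠ ∞ := ((measure_mono hsub).trans_lt (by simp [hν1])).ne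
    rw [measure_sdiff hsub measurableSet_ball.nullMeasurableSet hb, hν1]
    exact tsub_le_iff_left.2 hνε
  have hνV : ν V ≤ sV.card * δ := by
    calc ν V ≤ ν (⋃ q ∈ sV, {u | u + q ∈ Ω} \ ball 0 ε) := by
          apply measure_mono
          intro u hu
          obtain ⟨q, hq, hqu⟩ := Set.mem_iUnion₂.1 (hsV hu)
          exact Set.mem_biUnion hq ⟨hqu, fun hb => hε1 hb hu⟩
      _ ≤ ∑ q ∈ sV, ν ({u | u + q ∈ Ω} \ ball 0 ε) := measure_biUnion_finset_le _ _
      _ ≤ sV.card * δ := by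
          rw [← nsmul_eq_mul]
          exact Finset.sum_le_card_nsmul _ _ _ hball
  have hνK : ν K ≤ sK.card := by
    calc ν K ≤ ν (⋃ q ∈ sK, {u | u + q ∈ Ω}) := measure_mono hsK
      _ ≤ ∑ q ∈ sK, ν {u | u + q ∈ Ω} := measure_biUnion_finset_le _ _
      _ = sK.card := by simp [hν1]
  have hbound : ∀ u, F u ≤ K.indicator (fun _ => η) u +
      V.indicator (fun _ => volume (frontier Ω)) u := by
    intro u
    by_cases hu : u ∈ V
    · rw [Set.indicator_of_mem hu]
      exact (hFle u).trans le_add_self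
    · by_cases h0 : F u = 0
      · simp [h0]
      · rw [Set.indicator_of_mem (hFK u h0)]
        exact (not_le.1 hu).le.trans le_self_add
  calc volume (frontier Ω) = ∫⁻ q in frontier Ω, ν {u | u + q ∈ Ω} := by simp [hν1]
    _ = ∫⁻ u, F u ∂ν :=
        (lintegral_measure_add_mem isClosed_frontier.measurableSet hopen.measurableSet ν).symm
    _ ≤ ∫⁻ u, (K.indicator (fun _ => η) u + V.indicator (fun _ => volume (frontier Ω)) u) ∂ν :=
        lintegral_mono hbound
    _ = η * ν K + volume (frontier Ω) * ν V := by
        rw [lintegral_add_left (measurable_const.indicator hK.measurableSet),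
          lintegral_indicator_const hK.measurableSet, lintegral_indicator_const hVclosed.measurableSet]
    _ ≤ η * sK.card + volume (frontier Ω) * (sV.card * δ) := by gcongr


/-! ### Building the measures from a spectrum. -/

theorem expFun_add {d : ℕ} (l x y : EuclideanSpace ℝ (Fin d)) :
    expFun l (x + y) = expFun l x * expFun l y := by
  simp only [expFun, inner_add_right, Complex.ofReal_add, mul_add, Complex.exp_add]

theorem enorm_toLp_sq {α : Type*} [MeasurableSpace α] {μ : Measure α} {f : α → ℂ}
    (hf : MemLp f 2 μ) : ‖hf.toLp f‖ₑ ^ 2 = ∫⁻ x, ‖f x‖ₑ ^ 2 ∂μ := by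
  rw [Lp.enorm_toLp]
  have := eLpNorm_nnreal_pow_eq_lintegral (μ := μ) (f := f) (p := 2) two_ne_zero
  simpa using this

theorem norm_sum_smul_sq_of_pairwise_orthogonal {H ι : Type*} [NormedAddCommGroup H]
    [InnerProductSpace ℂ H] {v : ι → H} (s : Finset ι)
    (hv : (s : Set ι).Pairwise fun i j => inner ℂ (v i) (v j) = 0) (a : ι → ℂ) :
    ‖∑ i ∈ s, a i • v i‖ ^ 2 = ∑ i ∈ s, ‖a i‖ ^ 2 * ‖v i‖ ^ 2 := by
  have : ((‖∑ i ∈ s, a i • v i‖ ^ 2 : ℝ) : ℂ) = ((∑ i ∈ s, ‖a i‖ ^ 2 * ‖v i‖ ^ 2 : ℝ) : ℂ) := by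
    push_cast
    have h0 := inner_self_eq_norm_sq_to_K (𝕜 := ℂ) (∑ i ∈ s, a i • v i)
    simp only [Complex.coe_algebraMap] at h0
    rw [← h0, sum_inner]
    refine Finset.sum_congr rfl fun i hi => ?_
    rw [inner_sum, Finset.sum_eq_single i]
    · rw [inner_smul_left, inner_smul_right, inner_self_eq_norm_sq_to_K, ← mul_assoc,
        Complex.conj_mul']
      rfl
    · intro j hj hji
      rw [inner_smul_left, inner_smul_right, hv hi hj hji.symm]
      simp
    · exact fun h => absurd hi h
  exact_mod_cast this

theorem memLp_sum_expFun {d : ℕ} {Ω : Set (EuclideanSpace ℝ (Fin d))}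
    (hΩ : Bornology.IsBounded Ω) (s : Finset (EuclideanSpace ℝ (Fin d)))
    (a : EuclideanSpace ℝ (Fin d) → ℂ) :
    MemLp (fun y => ∑ l ∈ s, a l * expFun l y) 2 (volume.restrict Ω) :=
  memLp_finsetSum s fun l _ => (memLp_expFun hΩ l).const_mul (a l)

theorem toLp_sum_expFun {d : ℕ} {Ω : Set (EuclideanSpace ℝ (Fin d))}
    (hΩ : Bornology.IsBounded Ω) (s : Finset (EuclideanSpace ℝ (Fin d)))
    (a : EuclideanSpace ℝ (Fin d) → ℂ) :
    (memLp_sum_expFun hΩ s a).toLp _ = ∑ l ∈ s, a l • expL2 hΩ l := by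
  apply Lp.ext
  have hsum : ⇑(∑ l ∈ s, a l • expL2 hΩ l) =ᵐ[volume.restrict Ω]
      ∑ l ∈ s, ⇑(a l • expL2 hΩ l) := Lp.coeFn_finsetSum s _
  have hall : ∀ᵐ y ∂volume.restrict Ω, ∀ l ∈ s, (a l • expL2 hΩ l) y = a l * expFun l y := by
    rw [eventually_all_finset]
    intro l _
    filter_upwards [Lp.coeFn_smul (a l) (expL2 hΩ l), (memLp_expFun hΩ l).coeFn_toLp]
      with y h1 h2
    rw [h1, Pi.smul_apply, smul_eq_mul, expL2, h2]
  filter_upwards [(memLp_sum_expFun hΩ s a).coeFn_toLp, hsum, hall] with y h1 h2 h3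
  rw [h1, h2, Finset.sum_apply]
  exact Finset.sum_congr rfl fun l hl => (h3 l hl).symm

/-- The square mean of a trigonometric polynomial with frequencies in an orthogonal set is the
same on all translates of `Ω`. -/
theorem lintegral_enorm_sum_expFun_add_sq {d : ℕ} {Ω : Set (EuclideanSpace ℝ (Fin d))}
    (hΩ : Bornology.IsBounded Ω) (s : Finset (EuclideanSpace ℝ (Fin d)))
    (hs : (s : Set (EuclideanSpace ℝ (Fin d))).Pairwise
      fun l l' => inner ℂ (expL2 hΩ l) (expL2 hΩ l') = 0)
    (a : EuclideanSpace ℝ (Fin d) → ℂ) (x : EuclideanSpace ℝ (Fin d)) :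
    ∫⁻ y in Ω, ‖∑ l ∈ s, a l * expFun l (x + y)‖ₑ ^ 2 = ‖∑ l ∈ s, a l • expL2 hΩ l‖ₑ ^ 2 := by
  have h1 : ∀ y, ∑ l ∈ s, a l * expFun l (x + y) = ∑ l ∈ s, (a l * expFun l x) * expFun l y :=
    fun y => Finset.sum_congr rfl fun l _ => by rw [expFun_add, mul_assoc]
  simp only [h1]
  rw [← enorm_toLp_sq (memLp_sum_expFun hΩ s fun l => a l * expFun l x), toLp_sum_expFun hΩ]
  -- Translation only multiplies the coefficients by unimodular factors, which Pythagoras does not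
  -- see.
  have h2 : ‖∑ l ∈ s, (a l * expFun l x) • expL2 hΩ l‖ ^ 2 = ‖∑ l ∈ s, a l • expL2 hΩ l‖ ^ 2 := by
    rw [norm_sum_smul_sq_of_pairwise_orthogonal s hs, norm_sum_smul_sq_of_pairwise_orthogonal s hs]
    simp [norm_expFun]
  have h3 := (pow_left_inj₀ (norm_nonneg _) (norm_nonneg _) two_ne_zero).1 h2
  rw [← ofReal_norm, ← ofReal_norm, h3]

/-- Approximation with small relative error by elements of a dense submodule. -/
theorem Submodule.exists_mem_enorm_sub_sq_lt {H : Type*} [NormedAddCommGroup H]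
    [InnerProductSpace ℂ H] {S : Submodule ℂ H} (hS : S.topologicalClosure = ⊤)
    {h : H} (hh0 : h ≠ 0) {δ : ℝ≥0∞} (hδ : δ ≠ 0) :
    ∃ f ∈ S, f ≠ 0 ∧ ‖f - h‖ₑ ^ 2 < δ * ‖f‖ₑ ^ 2 := by
  have hcl : h ∈ closure (S : Set H) := by
    rw [← Submodule.topologicalClosure_coe, hS]
    trivial
  have hev : ∀ᶠ f in 𝓝 h, f ≠ 0 ∧ ‖f - h‖ₑ ^ 2 < δ * ‖f‖ₑ ^ 2 := by
    refine (isOpen_ne.eventually_mem hh0).and ?_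
    have hc1 : Tendsto (fun f => ‖f - h‖ₑ ^ 2) (𝓝 h) (𝓝 0) := by
      have : Continuous fun f : H => ‖f - h‖ₑ ^ 2 := by fun_prop
      simpa using this.tendsto h
    have hc2 : Tendsto (fun f : H => δ * ‖f‖ₑ ^ 2) (𝓝 h) (𝓝 (δ * ‖h‖ₑ ^ 2)) := by
      refine ENNReal.Tendsto.const_mul ?_ (Or.inl (by simpa using hh0))
      have : Continuous fun f : H => ‖f‖ₑ ^ 2 := by fun_prop
      exact this.tendsto h
    exact hc1.eventually_lt hc2 (by simpa [pos_iff_ne_zero, hδ] using hh0)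
  exact ((mem_closure_iff_frequently.1 hcl).and_eventually hev).exists

theorem IsSpectrum.exists_measure {d : ℕ} {Ω Λ : Set (EuclideanSpace ℝ (Fin d))}
    {hΩ : Bornology.IsBounded Ω} (hΛ : IsSpectrum hΩ Λ) (hopen : IsOpen Ω)
    {p : EuclideanSpace ℝ (Fin d)} (hp : p ∈ Ω) {ε : ℝ} (hε : 0 < ε) {δ : ℝ≥0∞} (hδ : δ ≠ 0) :
    ∃ ν : Measure (EuclideanSpace ℝ (Fin d)), SFinite ν ∧
      (∀ x, ν {u | u + x ∈ Ω} = 1) ∧ 1 ≤ ν (ball 0 ε) + δ := by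
  have hfinΩ : IsFiniteMeasure (volume.restrict Ω) :=
    isFiniteMeasure_restrict.2 hΩ.measure_lt_top.ne
  have hmem : MemLp ((ball p ε).indicator fun _ => (1 : ℂ)) 2 (volume.restrict Ω) :=
    (memLp_const 1).indicator measurableSet_ball
  set h : Lp ℂ 2 (volume.restrict Ω) := hmem.toLp _ with hh
  have hh0 : h ≠ 0 := by
    intro h0
    have h0 := hmem.coeFn_toLp.symm.trans (Lp.eq_zero_iff_ae_eq_zero.1 h0)
    have hpos : 0 < volume (ball p ε ∩ Ω) :=
      (isOpen_ball.inter hopen).measure_pos volume ⟨p, mem_ball_self hε, hp⟩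
    rw [Set.indicator_ae_eq_zero, Function.support_const one_ne_zero, Set.inter_univ,
      Measure.restrict_apply measurableSet_ball] at h0
    exact hpos.ne' h0
  -- The error is measured against `f` itself, so that dividing by `N = ‖f‖²` leaves exactly `δ`.
  obtain ⟨f, hf, hf0, hfh⟩ := Submodule.exists_mem_enorm_sub_sq_lt hΛ.complete hh0 hδ
  obtain ⟨c, hc, rfl⟩ := (Finsupp.mem_span_image_iff_linearCombination ℂ).1 hf
  rw [Finsupp.linearCombination_apply, Finsupp.sum] at hf0 hfh
  set N : ℝ≥0∞ := ‖∑ l ∈ c.support, c l • expL2 hΩ l‖ₑ ^ 2 with hN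
  have hN0 : N ≠ 0 := by simpa [hN] using hf0
  have hNtop : N ≠ ∞ := by simp [hN]
  have horth := hΛ.orthogonal.mono hc
  set T : EuclideanSpace ℝ (Fin d) → ℂ := fun y => ∑ l ∈ c.support, c l * expFun l y with hT
  have hTc : Continuous T :=
    continuous_finsetSum _ fun l _ => continuous_const.mul (continuous_expFun l)
  have hTm : Measurable fun u => ‖T u‖ₑ ^ 2 := by
    have : Continuous fun u => ‖T u‖ₑ ^ 2 := by fun_prop
    exact this.measurable
  have hsub : ∀ (S : Set (EuclideanSpace ℝ (Fin d))) (x y : EuclideanSpace ℝ (Fin d)),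
      MeasurableSet S → ∫⁻ u in {u | u + x ∈ S}, ‖T (y + u)‖ₑ ^ 2
        = ∫⁻ z in S, ‖T (y - x + z)‖ₑ ^ 2 := by
    intro S x y hS
    rw [← (measurePreserving_add_right volume x).setLIntegral_comp_preimage hS
      (f := fun z => ‖T (y - x + z)‖ₑ ^ 2) (hTm.comp (measurable_const_add (y - x)))]
    refine lintegral_congr fun u => ?_
    congr 3
    abel
  have hmass : ∀ x, ∫⁻ u in {u | u + x ∈ Ω}, ‖T (p + u)‖ₑ ^ 2 = N := fun x => by
    rw [hsub _ _ _ hopen.measurableSet]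
    exact lintegral_enorm_sum_expFun_add_sq hΩ c.support horth c _
  -- Off the ball the indicator vanishes, so `T` is there its own approximation error.
  have hout : ∫⁻ z in Ω \ ball p ε, ‖T z‖ₑ ^ 2 ≤ δ * N := by
    refine le_trans ?_ hfh.le
    rw [← toLp_sum_expFun, hh, ← MemLp.toLp_sub, enorm_toLp_sq]
    calc ∫⁻ z in Ω \ ball p ε, ‖T z‖ₑ ^ 2
        = ∫⁻ z in Ω \ ball p ε, ‖((fun y => ∑ l ∈ c.support, c l * expFun l y) -
            (ball p ε).indicator fun _ => (1 : ℂ)) z‖ₑ ^ 2 := by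
          refine setLIntegral_congr_fun (hopen.measurableSet.diff measurableSet_ball) fun z hz => ?_
          simp [hT, Set.indicator_of_notMem hz.2]
      _ ≤ _ := lintegral_mono_set Set.sdiff_subset
  have hin : N ≤ (∫⁻ u in ball 0 ε, ‖T (p + u)‖ₑ ^ 2) + δ * N := by
    have hb : ball (0 : EuclideanSpace ℝ (Fin d)) ε = {u | u + p ∈ ball p ε} := by
      ext u
      simp
    rw [hb, hsub _ _ _ measurableSet_ball]
    have h0 := lintegral_enorm_sum_expFun_add_sq hΩ c.support horth c 0
    simp only [zero_add] at h0
    simp only [sub_self, zero_add]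
    rw [hN, ← h0]
    calc ∫⁻ z in Ω, ‖T z‖ₑ ^ 2
        ≤ ∫⁻ z in ball p ε ∪ Ω \ ball p ε, ‖T z‖ₑ ^ 2 := by
          apply lintegral_mono_set
          intro z hz
          by_cases hzb : z ∈ ball p ε
          · exact Or.inl hzb
          · exact Or.inr ⟨hz, hzb⟩
      _ ≤ (∫⁻ z in ball p ε, ‖T z‖ₑ ^ 2) + ∫⁻ z in Ω \ ball p ε, ‖T z‖ₑ ^ 2 :=
          lintegral_union_le _ _ _
      _ ≤ _ := by
          gcongr
          rw [h0]
          exact hout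
  have hA : ∀ x, MeasurableSet {u | u + x ∈ Ω} := fun x =>
    (hopen.preimage (continuous_add_const x)).measurableSet
  refine ⟨N⁻¹ • volume.withDensity fun u => ‖T (p + u)‖ₑ ^ 2, inferInstance, fun x => ?_, ?_⟩
  · rw [Measure.smul_apply, withDensity_apply _ (hA x), hmass, smul_eq_mul,
      ENNReal.inv_mul_cancel hN0 hNtop]
  · rw [Measure.smul_apply, withDensity_apply _ measurableSet_ball, smul_eq_mul]
    calc (1 : ℝ≥0∞) = N⁻¹ * N := (ENNReal.inv_mul_cancel hN0 hNtop).symm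
      _ ≤ N⁻¹ * ((∫⁻ u in ball 0 ε, ‖T (p + u)‖ₑ ^ 2) + δ * N) := by gcongr
      _ = _ := by
        rw [mul_add, mul_comm δ, ← mul_assoc N⁻¹ N, ENNReal.inv_mul_cancel hN0 hNtop, one_mul]

/-- The boundary of a bounded, open, spectral subset of `ℝ^d` is Lebesgue-null. -/
theorem theorem3p6 {d : ℕ} (Ω : Set (EuclideanSpace ℝ (Fin d)))
    (hbdd : Bornology.IsBounded Ω) (hopen : IsOpen Ω) (hspec : IsSpectral Ω) :
    volume (frontier Ω) = 0 := by
  obtain ⟨-, hpos, hΩ, Λ, hΛ⟩ := hspec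
  obtain ⟨p, hp⟩ := nonempty_of_measure_ne_zero hpos.ne'
  exact volume_frontier_eq_zero_of_forall_exists_measure hbdd hopen ⟨p, hp⟩
    fun ε hε δ hδ => hΛ.exists_measure hopen hp hε hδ
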